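/- Let $n\in\mathbb{N}$, let $\gamma_n$ be the standard Gaussian measure on $\mathbb{R}^n$, and let $u:\mathbb{R}^n\to\mathbb{R}$ be a smooth compactly supported function, not identically zero, such that $$\int_{\mathbb{R}^n} x_i x_j\, u(x)^2 \,d\gamma_n(x) = \delta_{ij}\,\|u\|_{L_2(\gamma_n)}^2 \qquad\text{for all } i,j\in\{1,\ldots,n\},$$ where $\delta_{ij}$ is the Kronecker delta. Then, for every $p\in[1,2)$, $$\frac{\|u\|_{L_2(\gamma_n)}^2-\|u\|_{L_p(\gamma_n)}^2}{\|u\|_{L_2(\gamma_n)}^2} \leq 1-\left[\det\left(\frac{4}{\|u\|_{L_2(\gamma_n)}^2}\int_{\mathbb{R}^n} (\nabla u)^{\otimes 2}\,d\gamma_n+\mathsf{Id}_n\right)\right]^{-\frac{2-p}{2p}},$$ where $\int_{\mathbb{R}^n}(\nabla u)^{\otimes 2}\,d\gamma_n$ is the $n\times n$ matrix with entries $\int_{\mathbb{R}^n}\partial_i u\,\partial_j u\,d\gamma_n$. -/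

import Mathlib

open MeasureTheory ProbabilityTheory
open scoped Gradient ContDiff ENNReal

/-- The matrix `∫ (∇u)^{⊗2} dγ_n`, whose `(i, j)` entry is `∫ ∂_i u ∂_j u dγ_n`, where `γ_n` is the
standard Gaussian measure on `ℝⁿ`. -/
noncomputable def gaussianGradientMatrix (n : ℕ) (u : EuclideanSpace ℝ (Fin n) → ℝ) :
    Matrix (Fin n) (Fin n) ℝ :=
  Matrix.of fun i j => ∫ x, (∇ u x) i * (∇ u x) j ∂(stdGaussian (EuclideanSpace ℝ (Fin n)))

/-- The norm `‖u‖_{L_p(γ_n)}` as a real number. -/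
noncomputable def gaussianLpNorm (n : ℕ) (p : ℝ) (u : EuclideanSpace ℝ (Fin n) → ℝ) : ℝ :=
  (eLpNorm u (ENNReal.ofReal p) (stdGaussian (EuclideanSpace ℝ (Fin n)))).toReal

/-! The deficit is controlled by entropy. Write `N = ∫ u² dγ` and `H = ∫ u² log u² dγ`. Jensen's
inequality for the probability density `u²/N` gives `∫ |u|^p dγ ≥ N exp((p-2)/2 · H/N)`
(`integral_rpow_ge_exp_entropy`), so it is enough to show `H ≤ N log N + (N/2) log det(4M/N + Id)`,
with `M` the gradient matrix (`gaussian_entropy_sq_le_log_det`).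

That bound is a Euclidean logarithmic Sobolev inequality in disguise. Put `v = u √g` with `g` the
Gaussian density. Isotropy turns the directional Fisher information `∫ (∂_b v)²` into `∫ (∂_b u)² dγ
+ N/4`, and fixes `∫ |x|² u² dγ = nN`. In an eigenbasis of `M`, choosing the best scale `l i` in
each direction produces the sum of the logarithms of the eigenvalues of `4M/N + Id`, which is the
logarithm of the determinant.

The Euclidean inequality, with one free scale per coordinate, is proved on the line by monotone
transport to a truncated Gaussian (`entropy_le_fisher_of_pos`). It passes to `ℝⁿ` because the
entropies of the two marginals of a density on a product are together bounded by the joint entropy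
(`entropy_marginals_le`). -/

/-! ### Logarithmic Sobolev inequality on the line, by transport. -/

/-- Monotone transport on the line: `T` is the solution of `∫_a^{T x} h = ∫_r^x k`. -/
theorem exists_hasDerivAt_transport {h k : ℝ → ℝ} (hh : Continuous h) (hk : Continuous k)
    {c : ℝ} (hc : 0 < c) (hch : ∀ t, c ≤ h t) (a r : ℝ) :
    ∃ T : ℝ → ℝ, (∀ x, HasDerivAt T (k x / h (T x)) x) ∧
      ∀ x y, ∫ t in a..y, h t = ∫ t in r..x, k t → T x = y := by
  set G : ℝ → ℝ := fun y => ∫ t in a..y, h t with hG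
  have hGd : ∀ y, HasDerivAt G (h y) y := fun y =>
    (hh.integral_hasStrictDerivAt a y).hasDerivAt
  have hGc : Continuous G := continuous_iff_continuousAt.2 fun y => (hGd y).continuousAt
  have hmono : StrictMono G := strictMono_of_deriv_pos fun y => by
    rw [(hGd y).deriv]; exact hc.trans_le (hch y)
  -- Since `h ≥ c > 0`, `G` grows at least linearly in both directions; hence it is onto and `T` is
  -- defined on the whole line.
  have hlin : Monotone fun y => G y - c * y := by
    apply monotone_of_deriv_nonneg
    · intro y; exact ((hGd y).sub ((hasDerivAt_id y).const_mul c)).differentiableAt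
    · intro y
      have := ((hGd y).sub ((hasDerivAt_id y).const_mul c)).deriv
      simp only [id, mul_one] at this
      have h2 : deriv (fun y => G y - c * y) y = h y - c := this
      rw [h2]; linarith [hch y]
  have hG0 : G a = 0 := by simp [hG]
  have hsurj : Function.Surjective G := by
    apply hGc.surjective
    · refine Filter.tendsto_atTop_mono' _ ?_
        (Filter.tendsto_atTop_add_const_right Filter.atTop (-(c * a))
          (Filter.tendsto_id.const_mul_atTop hc))
      filter_upwards [Filter.eventually_ge_atTop a] with y hy
      have := hlin hy
      simp only [hG0, id] at this ⊢
      linarith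
    · refine Filter.tendsto_atBot_mono' _ ?_
        (Filter.tendsto_atBot_add_const_right Filter.atBot (-(c * a))
          (Filter.tendsto_id.const_mul_atBot hc))
      filter_upwards [Filter.eventually_le_atBot a] with y hy
      have := hlin hy
      simp only [hG0, id] at this ⊢
      linarith
  set e : ℝ ≃o ℝ := hmono.orderIsoOfSurjective G hsurj with he
  have hsymm : ∀ z, HasDerivAt e.symm (h (e.symm z))⁻¹ z := fun z =>
    HasDerivAt.of_local_left_inverse (f := G) e.symm.continuous.continuousAt (hGd _)
      (hc.trans_le (hch _)).ne' (Filter.Eventually.of_forall fun w => e.apply_symm_apply w)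
  refine ⟨fun x => e.symm (∫ t in r..x, k t), fun x => ?_, fun x y hxy => ?_⟩
  · have := (hsymm (∫ t in r..x, k t)).comp x (hk.integral_hasStrictDerivAt r x).hasDerivAt
    rw [div_eq_inv_mul]; exact this
  · change e.symm (∫ t in r..x, k t) = y
    rw [← hxy]
    exact e.symm_apply_apply y

theorem log_le_mul_sub_one_sub_log {x l : ℝ} (hx : 0 < x) (hl : 0 < l) :
    Real.log x ≤ l * x - 1 - Real.log l := by
  have := Real.log_le_sub_one_of_pos (mul_pos hl hx)
  rw [Real.log_mul hl.ne' hx.ne'] at this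
  linarith

/-- Transport `ρ/N` on `[-R, R]` to the Gaussian conditioned to `[-a, a]` by an increasing `T`. The
logarithm of the change of variables formula expresses `log ρ` through `log T'` and `T²/2`; then
`log T' ≤ l T' - 1 - log l`, and `ρ T'` is integrated by parts. Truncating at `a` keeps the boundary
terms finite, and `l` stays free for later optimisation. -/
theorem entropy_le_fisher_of_pos {ρ : ℝ → ℝ} (hρ : ContDiff ℝ 1 ρ) (hpos : ∀ x, 0 < ρ x)
    {R a l : ℝ} (hR : 0 < R) (ha : 0 < a) (hl : 0 < l) :
    (∫ x in -R..R, ρ x * Real.log (ρ x)) -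
        (∫ x in -R..R, ρ x) * Real.log (∫ x in -R..R, ρ x) ≤
      l * a * (ρ R + ρ (-R)) + (∫ x in -R..R, l ^ 2 / 2 * (deriv ρ x ^ 2 / ρ x)) -
        (∫ x in -R..R, ρ x) *
          (1 + Real.log l + Real.log (∫ t in -a..a, Real.exp (-(1 / 2) * t ^ 2))) := by
  have hρc : Continuous ρ := hρ.continuous
  have hρd : ∀ x, HasDerivAt ρ (deriv ρ x) x := fun x =>
    (hρ.differentiable one_ne_zero x).hasDerivAt
  have hρ'c : Continuous (deriv ρ) := hρ.continuous_deriv le_rfl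
  set N := ∫ x in -R..R, ρ x with hN
  set Z := ∫ t in -a..a, Real.exp (-(1 / 2) * t ^ 2) with hZ
  have hNpos : 0 < N := intervalIntegral.intervalIntegral_pos_of_pos
    (hρc.intervalIntegrable _ _) hpos (by linarith)
  have hZpos : 0 < Z := intervalIntegral.intervalIntegral_pos_of_pos
    (Continuous.intervalIntegrable (by fun_prop) _ _) (fun t => Real.exp_pos _) (by linarith)
  -- The Gaussian on `[-a, a]`, continued by its endpoint value: this changes nothing where `T`
  -- takes its values on `[-R, R]`, but gives the positive lower bound that the transport lemma
  -- needs.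
  set h : ℝ → ℝ := fun t => max (Real.exp (-(1 / 2) * t ^ 2)) (Real.exp (-(1 / 2) * a ^ 2)) with hh
  have hheq : ∀ t ∈ Set.Icc (-a) a, h t = Real.exp (-(1 / 2) * t ^ 2) := by
    intro t ht
    apply max_eq_left
    apply Real.exp_le_exp.2
    have : t ^ 2 ≤ a ^ 2 := sq_le_sq' ht.1 ht.2
    linarith
  have hhc : Continuous h := by fun_prop
  obtain ⟨T, hTd, hT⟩ := exists_hasDerivAt_transport hhc (k := fun x => Z / N * ρ x)
    (by fun_prop) (Real.exp_pos (-(1 / 2) * a ^ 2)) (fun t => le_max_right _ _) (-a) (-R)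
  have hTl : T (-R) = -a := hT _ _ (by simp)
  have hTr : T R = a := by
    apply hT
    rw [intervalIntegral.integral_const_mul, ← hN, div_mul_cancel₀ _ hNpos.ne', hZ]
    apply intervalIntegral.integral_congr
    intro t ht
    rw [Set.uIcc_of_le (by linarith)] at ht
    exact hheq t ht
  have hTc : Continuous T := continuous_iff_continuousAt.2 fun x => (hTd x).continuousAt
  have hhpos : ∀ t, 0 < h t := fun t => (Real.exp_pos _).trans_le (le_max_left _ _)
  have hT'pos : ∀ x, 0 < Z / N * ρ x / h (T x) := fun x =>
    div_pos (mul_pos (div_pos hZpos hNpos) (hpos x)) (hhpos _)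
  have hTm : StrictMono T := strictMono_of_deriv_pos fun x => by
    rw [(hTd x).deriv]; exact hT'pos x
  set T' : ℝ → ℝ := fun x => Z / N * ρ x / h (T x) with hT'
  have hT'c : Continuous T' :=
    (continuous_const.mul hρc).div (hhc.comp hTc) fun x => (hhpos _).ne'
  -- The factor of `l` is the exact derivative of `ρ T`, so it integrates to a boundary term.
  have key : ∀ x ∈ Set.Icc (-R) R,
      ρ x * Real.log (ρ x) - ρ x * Real.log N ≤
        l * (deriv ρ x * T x + ρ x * T' x) + l ^ 2 / 2 * (deriv ρ x ^ 2 / ρ x) -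
          ρ x * (1 + Real.log l + Real.log Z) := by
    intro x hx
    have hTx : T x ∈ Set.Icc (-a) a := by
      rw [← hTl, ← hTr]; exact ⟨hTm.monotone hx.1, hTm.monotone hx.2⟩
    have hlog : Real.log (T' x) = Real.log Z - Real.log N + Real.log (ρ x) + T x ^ 2 / 2 := by
      rw [hT']
      simp only
      rw [Real.log_div (mul_pos (div_pos hZpos hNpos) (hpos x)).ne' (hhpos _).ne',
        Real.log_mul (div_pos hZpos hNpos).ne' (hpos x).ne', Real.log_div hZpos.ne' hNpos.ne',
        hheq _ hTx, Real.log_exp]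
      ring
    have h1 := log_le_mul_sub_one_sub_log (hT'pos x) hl
    change Real.log (T' x) ≤ l * T' x - 1 - Real.log l at h1
    rw [hlog] at h1
    have h2 : ρ x * (Real.log (ρ x) - Real.log N) ≤
        ρ x * (l * T' x - 1 - Real.log l - Real.log Z - T x ^ 2 / 2) :=
      mul_le_mul_of_nonneg_left (by linarith) (hpos x).le
    -- Completing the square trades the cross term `ρ' T` for Fisher information plus `ρ T²/2`,
    -- which cancels the Gaussian exponent in `log T'`.
    have h3 : 0 ≤ l * (deriv ρ x * T x) + l ^ 2 / 2 * (deriv ρ x ^ 2 / ρ x) +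
        ρ x * (T x ^ 2 / 2) := by
      have : l * (deriv ρ x * T x) + l ^ 2 / 2 * (deriv ρ x ^ 2 / ρ x) + ρ x * (T x ^ 2 / 2) =
          (l * deriv ρ x + ρ x * T x) ^ 2 / (2 * ρ x) := by
        have := (hpos x).ne'
        field_simp
        ring
      rw [this]
      exact div_nonneg (sq_nonneg _) (by linarith [hpos x])
    nlinarith
  have hlogc : Continuous fun x => Real.log (ρ x) := hρc.log fun x => (hpos x).ne'
  have hFc : Continuous fun x => deriv ρ x ^ 2 / ρ x :=
    (hρ'c.pow 2).div hρc fun x => (hpos x).ne'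
  have hint := intervalIntegral.integral_mono_on (μ := volume) (by linarith : -R ≤ R)
    (Continuous.intervalIntegrable (by fun_prop) _ _)
    (Continuous.intervalIntegrable (by fun_prop) _ _) key
  have hFTC : ∫ x in -R..R, (deriv ρ x * T x + ρ x * T' x) = ρ R * T R - ρ (-R) * T (-R) :=
    intervalIntegral.integral_eq_sub_of_hasDerivAt (f := fun x => ρ x * T x)
      (fun x _ => (hρd x).mul (hTd x))
      (Continuous.intervalIntegrable (by fun_prop) _ _)
  rw [intervalIntegral.integral_sub (Continuous.intervalIntegrable (by fun_prop) _ _)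
      (Continuous.intervalIntegrable (by fun_prop) _ _),
    intervalIntegral.integral_sub (Continuous.intervalIntegrable (by fun_prop) _ _)
      (Continuous.intervalIntegrable (by fun_prop) _ _),
    intervalIntegral.integral_add (Continuous.intervalIntegrable (by fun_prop) _ _)
      (Continuous.intervalIntegrable (by fun_prop) _ _),
    intervalIntegral.integral_mul_const, intervalIntegral.integral_mul_const,
    intervalIntegral.integral_const_mul l, hFTC, ← hN, hTl, hTr] at hint
  linarith

/-- Apply the positive case to `v² + ε`. Letting `ε → 0` with `a` fixed removes the boundary term
`2laε`; only then does `a → ∞`, turning the truncated Gaussian mass into `√(2π)`. -/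
theorem entropy_sq_le_fisher_interval {v : ℝ → ℝ} (hv : ContDiff ℝ 1 v) {R l : ℝ} (hR : 0 < R)
    (hvl : v (-R) = 0) (hvr : v R = 0) (hl : 0 < l) :
    (∫ x in -R..R, v x ^ 2 * Real.log (v x ^ 2)) -
        (∫ x in -R..R, v x ^ 2) * Real.log (∫ x in -R..R, v x ^ 2) ≤
      2 * l ^ 2 * (∫ x in -R..R, deriv v x ^ 2) -
        (∫ x in -R..R, v x ^ 2) * (1 + Real.log l + Real.log (2 * Real.pi) / 2) := by
  have hvc : Continuous v := hv.continuous
  have hv'c : Continuous (deriv v) := hv.continuous_deriv le_rfl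
  have step : ∀ a : ℝ, 0 < a → (∫ x in -R..R, v x ^ 2 * Real.log (v x ^ 2)) -
        (∫ x in -R..R, v x ^ 2) * Real.log (∫ x in -R..R, v x ^ 2) ≤
      2 * l ^ 2 * (∫ x in -R..R, deriv v x ^ 2) -
        (∫ x in -R..R, v x ^ 2) *
          (1 + Real.log l + Real.log (∫ t in -a..a, Real.exp (-(1 / 2) * t ^ 2))) := by
    intro a ha
    set Z := ∫ t in -a..a, Real.exp (-(1 / 2) * t ^ 2)
    set N : ℝ → ℝ := fun ε => ∫ x in -R..R, (v x ^ 2 + ε) with hN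
    set H : ℝ → ℝ := fun ε => ∫ x in -R..R, (v x ^ 2 + ε) * Real.log (v x ^ 2 + ε) with hH
    have hNc : Continuous N :=
      intervalIntegral.continuous_parametric_intervalIntegral_of_continuous'
        (by simp only [Function.uncurry_def]; fun_prop) _ _
    have hHc : Continuous H := by
      apply intervalIntegral.continuous_parametric_intervalIntegral_of_continuous'
      simp only [Function.uncurry_def]
      exact Real.continuous_mul_log.comp (by fun_prop : Continuous fun p : ℝ × ℝ => v p.2 ^ 2 + p.1)
    have hNlog : Continuous fun ε => N ε * Real.log (N ε) := Real.continuous_mul_log.comp hNc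
    have hε : ∀ ε : ℝ, 0 < ε → H ε - N ε * Real.log (N ε) ≤ l * a * (2 * ε) +
        2 * l ^ 2 * (∫ x in -R..R, deriv v x ^ 2) - N ε * (1 + Real.log l + Real.log Z) := by
      intro ε he
      have hρpos : ∀ x, 0 < v x ^ 2 + ε := fun x => by positivity
      have hd : ∀ x, deriv (fun x => v x ^ 2 + ε) x = 2 * v x * deriv v x := by
        intro x
        have h0 := (((hv.differentiable one_ne_zero x).hasDerivAt.pow 2).add_const ε).deriv
        simpa using h0
      have h1 := entropy_le_fisher_of_pos (ρ := fun x => v x ^ 2 + ε)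
        ((hv.pow 2).add contDiff_const) hρpos hR ha hl
      have h2 : (∫ x in -R..R, l ^ 2 / 2 * (deriv (fun x => v x ^ 2 + ε) x ^ 2 / (v x ^ 2 + ε))) ≤
          2 * l ^ 2 * (∫ x in -R..R, deriv v x ^ 2) := by
        rw [← intervalIntegral.integral_const_mul]
        apply intervalIntegral.integral_mono_on (by linarith)
        · apply Continuous.intervalIntegrable
          simp only [hd]
          exact continuous_const.mul (Continuous.div (by fun_prop) (by fun_prop)
            fun x => (hρpos x).ne')
        · exact Continuous.intervalIntegrable (by fun_prop) _ _
        · intro x _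
          rw [hd]
          -- The Fisher information of `v² + ε` is at most `4 v'²` pointwise, uniformly in `ε`.
          have : (2 * v x * deriv v x) ^ 2 / (v x ^ 2 + ε) ≤ 4 * deriv v x ^ 2 := by
            rw [div_le_iff₀ (hρpos x)]
            nlinarith [mul_nonneg he.le (sq_nonneg (deriv v x))]
          have := mul_le_mul_of_nonneg_left this (by positivity : 0 ≤ l ^ 2 / 2)
          linarith
      simp only [hvl, hvr] at h1
      change H ε - N ε * Real.log (N ε) ≤ _ at h1
      change _ ≤ _ + _ - N ε * _ at h1
      have h3 : l * a * ((0:ℝ) ^ 2 + ε + (0 ^ 2 + ε)) = l * a * (2 * ε) := by ring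
      rw [h3] at h1
      linarith
    have hlim := le_of_tendsto_of_tendsto (b := nhdsWithin (0:ℝ) (Set.Ioi 0))
      ((hHc.sub hNlog).tendsto 0 |>.mono_left nhdsWithin_le_nhds)
      ((by fun_prop : Continuous fun ε => l * a * (2 * ε) +
        2 * l ^ 2 * (∫ x in -R..R, deriv v x ^ 2) -
          N ε * (1 + Real.log l + Real.log Z)).tendsto 0 |>.mono_left nhdsWithin_le_nhds)
      (Filter.eventually_of_mem self_mem_nhdsWithin hε)
    simpa [hH, hN] using hlim
  have hZ : Filter.Tendsto (fun a : ℝ => ∫ t in -a..a, Real.exp (-(1 / 2) * t ^ 2)) Filter.atTop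
      (nhds (Real.sqrt (2 * Real.pi))) := by
    have := MeasureTheory.intervalIntegral_tendsto_integral
      (integrable_exp_neg_mul_sq (by norm_num : (0:ℝ) < 1 / 2))
      Filter.tendsto_neg_atTop_atBot (Filter.tendsto_id (α := ℝ) (x := Filter.atTop))
    rw [integral_gaussian] at this
    rwa [show Real.pi / (1 / 2) = 2 * Real.pi by ring] at this
  have hlogZ := hZ.log (by positivity)
  rw [Real.log_sqrt (by positivity)] at hlogZ
  refine ge_of_tendsto (Filter.Tendsto.sub tendsto_const_nhds
    (Filter.Tendsto.mul tendsto_const_nhds (Filter.Tendsto.add tendsto_const_nhds hlogZ))) ?_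
  filter_upwards [Filter.eventually_gt_atTop 0] with a ha using step a ha

/-- Scaled Euclidean logarithmic Sobolev inequality on the line. -/
theorem entropy_sq_le_fisher_real {v : ℝ → ℝ} (hv : ContDiff ℝ 1 v) (hs : HasCompactSupport v)
    {l : ℝ} (hl : 0 < l) :
    ∫ x, v x ^ 2 * Real.log (v x ^ 2) ≤
      (∫ x, v x ^ 2) * Real.log (∫ x, v x ^ 2) + 2 * l ^ 2 * (∫ x, deriv v x ^ 2) -
        (∫ x, v x ^ 2) * (1 + Real.log l + Real.log (2 * Real.pi) / 2) := by
  obtain ⟨r, hr⟩ := hs.isCompact.isBounded.subset_closedBall 0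
  -- The margin puts the support strictly inside `(-R, R)`, so `v` and `v'` vanish at the endpoints.
  set R := max r 0 + 1 with hRdef
  have hR : 0 < R := by positivity
  have hrR : r < R := by have := le_max_left r 0; linarith
  have hz : ∀ x, R ≤ |x| → x ∉ tsupport v := by
    intro x hx hxs
    have := hr hxs
    rw [mem_closedBall_zero_iff, Real.norm_eq_abs] at this
    linarith
  have hv0 : ∀ x, R ≤ |x| → v x = 0 := fun x hx => image_eq_zero_of_notMem_tsupport (hz x hx)
  have hd0 : ∀ x, R ≤ |x| → deriv v x = 0 := fun x hx => by
    by_contra h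
    exact hz x hx (support_deriv_subset h)
  have hsub : ∀ g : ℝ → ℝ, (∀ x, R ≤ |x| → g x = 0) → Function.support g ⊆ Set.Ioc (-R) R := by
    intro g hg x hx
    have : |x| < R := by
      by_contra h
      exact hx (hg x (not_lt.1 h))
    rw [abs_lt] at this
    exact ⟨this.1, this.2.le⟩
  have := entropy_sq_le_fisher_interval hv hR (hv0 _ (by rw [abs_neg]; exact le_abs_self _))
    (hv0 _ (le_abs_self _)) hl
  rw [intervalIntegral.integral_eq_integral_of_support_subset
      (hsub (fun x => v x ^ 2 * Real.log (v x ^ 2)) fun x hx => by simp [hv0 x hx]),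
    intervalIntegral.integral_eq_integral_of_support_subset
      (hsub (fun x => v x ^ 2) fun x hx => by simp [hv0 x hx]),
    intervalIntegral.integral_eq_integral_of_support_subset
      (hsub (fun x => deriv v x ^ 2) fun x hx => by simp [hd0 x hx])] at this
  linarith

/-! ### Marginals of compactly supported densities and their entropies. -/

section Marginal

set_option linter.unusedSectionVars false

variable {X Y : Type*} [TopologicalSpace X] [T2Space X] [LocallyCompactSpace X]
  [SecondCountableTopology X] [MeasurableSpace X] [BorelSpace X]
  [TopologicalSpace Y] [T2Space Y] [LocallyCompactSpace Y]
  [SecondCountableTopology Y] [MeasurableSpace Y] [BorelSpace Y]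
  {μ : Measure X} [IsFiniteMeasureOnCompacts μ] [SFinite μ]
  {ν : Measure Y} [IsFiniteMeasureOnCompacts ν] [SFinite ν]

theorem HasCompactSupport.slice_left {E : Type*} [Zero E] {f : X × Y → E}
    (hf : HasCompactSupport f) (y : Y) : HasCompactSupport fun x => f (x, y) := by
  refine HasCompactSupport.intro (hf.isCompact.image continuous_fst) fun x hx => ?_
  by_contra h
  exact hx ⟨(x, y), subset_tsupport f h, rfl⟩

theorem HasCompactSupport.slice_right {E : Type*} [Zero E] {f : X × Y → E}
    (hf : HasCompactSupport f) (x : X) : HasCompactSupport fun y => f (x, y) := by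
  refine HasCompactSupport.intro (hf.isCompact.image continuous_snd) fun y hy => ?_
  by_contra h
  exact hy ⟨(x, y), subset_tsupport f h, rfl⟩

theorem HasCompactSupport.continuous_integral_right {f : X × Y → ℝ} (hfc : Continuous f)
    (hf : HasCompactSupport f) : Continuous fun x => ∫ y, f (x, y) ∂ν := by
  have hK : IsCompact (Prod.snd '' tsupport f) := hf.isCompact.image continuous_snd
  have : (fun x => ∫ y, f (x, y) ∂ν) = fun x => ∫ y in Prod.snd '' tsupport f, f (x, y) ∂ν := by
    funext x
    refine (setIntegral_eq_integral_of_forall_compl_eq_zero fun y hy => ?_).symm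
    by_contra h
    exact hy ⟨(x, y), subset_tsupport f h, rfl⟩
  rw [this]
  exact continuous_parametric_integral_of_continuous (f := fun x y => f (x, y)) hfc hK

theorem HasCompactSupport.integral_right {f : X × Y → ℝ}
    (hf : HasCompactSupport f) : HasCompactSupport fun x => ∫ y, f (x, y) ∂ν := by
  refine HasCompactSupport.intro (hf.isCompact.image continuous_fst) fun x hx => ?_
  have : ∀ y, f (x, y) = 0 := fun y => by
    by_contra h
    exact hx ⟨(x, y), subset_tsupport f h, rfl⟩
  simp [this]

theorem HasCompactSupport.comp_prod_swap {f : X × Y → ℝ} (hf : HasCompactSupport f) :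
    HasCompactSupport (f ∘ Prod.swap) :=
  hf.comp_isClosedEmbedding (Homeomorph.prodComm Y X).isClosedEmbedding

theorem HasCompactSupport.continuous_integral_left {f : X × Y → ℝ} (hfc : Continuous f)
    (hf : HasCompactSupport f) : Continuous fun y => ∫ x, f (x, y) ∂μ :=
  HasCompactSupport.continuous_integral_right (f := f ∘ Prod.swap)
    (hfc.comp continuous_swap) hf.comp_prod_swap

theorem HasCompactSupport.integral_left {f : X × Y → ℝ}
    (hf : HasCompactSupport f) : HasCompactSupport fun y => ∫ x, f (x, y) ∂μ :=
  HasCompactSupport.integral_right (f := f ∘ Prod.swap) hf.comp_prod_swap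

theorem HasCompactSupport.mul_log {Z : Type*} [TopologicalSpace Z] {g : Z → ℝ}
    (hg : HasCompactSupport g) : HasCompactSupport fun z => g z * Real.log (g z) :=
  hg.mul_right

/-- The product of a density with the logarithm of its marginal is integrable. -/
theorem integrable_mul_log_marginal {f : X × Y → ℝ} (hfc : Continuous f)
    (hf : HasCompactSupport f) (hf0 : ∀ z, 0 ≤ f z) :
    Integrable (fun z : X × Y => f z * Real.log (∫ y, f (z.1, y) ∂ν)) (μ.prod ν) := by
  set F : X → ℝ := fun x => ∫ y, f (x, y) ∂ν with hF
  have hFc : Continuous F := HasCompactSupport.continuous_integral_right hfc hf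
  have hFs : HasCompactSupport F := hf.integral_right
  -- The integrand may be discontinuous where the marginal vanishes, so compact support does not
  -- settle integrability. Integrating its norm along fibres gives `|F log F|`, which is continuous
  -- with compact support.
  refine (integrable_prod_iff ?_).2 ⟨Filter.Eventually.of_forall fun x => ?_, ?_⟩
  · have : Measurable fun z : X × Y => f z * Real.log (F z.1) :=
      hfc.measurable.mul ((hFc.measurable.comp measurable_fst).log)
    exact this.aestronglyMeasurable
  · exact (Continuous.integrable_of_hasCompactSupport (μ := ν) (f := fun y => f (x, y))
      (by fun_prop) (hf.slice_right x)).mul_const (Real.log (F x))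
  · have : (fun x => ∫ y, ‖f (x, y) * Real.log (F x)‖ ∂ν) = fun x => |F x * Real.log (F x)| := by
      funext x
      have h0 : 0 ≤ F x := integral_nonneg fun y => hf0 _
      simp only [norm_mul, Real.norm_eq_abs, abs_of_nonneg (hf0 _), abs_mul, abs_of_nonneg h0]
      rw [integral_mul_const]
    change Integrable (fun x => ∫ y, ‖f (x, y) * Real.log (F x)‖ ∂ν) μ
    rw [this]
    exact ((Real.continuous_mul_log.comp hFc).integrable_of_hasCompactSupport hFs.mul_log).abs

theorem integral_mul_log_marginal {f : X × Y → ℝ} (hfc : Continuous f)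
    (hf : HasCompactSupport f) (hf0 : ∀ z, 0 ≤ f z) :
    ∫ z, f z * Real.log (∫ y, f (z.1, y) ∂ν) ∂(μ.prod ν) =
      ∫ x, (∫ y, f (x, y) ∂ν) * Real.log (∫ y, f (x, y) ∂ν) ∂μ := by
  rw [integral_prod _ (integrable_mul_log_marginal hfc hf hf0)]
  simp only [integral_mul_const]

/-- This is `log s ≤ s - 1` at `s = ab/(Nt)`, multiplied by `t`. Positivity of `a` and `b` is needed
only where `t > 0`, which rules out the convention `log 0 = 0` there. -/
theorem mul_log_add_mul_log_le {t a b N : ℝ} (ht : 0 ≤ t) (ha : 0 ≤ a) (hb : 0 ≤ b)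
    (hat : 0 < t → 0 < a) (hbt : 0 < t → 0 < b) (hN : 0 < N) :
    t * Real.log a + t * Real.log b ≤
      t * Real.log t + t * Real.log N + a * b / N - t := by
  rcases ht.eq_or_lt with rfl | ht
  · simp; positivity
  · have ha := hat ht
    have hb := hbt ht
    have h := Real.log_le_sub_one_of_pos (div_pos (mul_pos ha hb) (mul_pos hN ht))
    rw [Real.log_div (mul_pos ha hb).ne' (mul_pos hN ht).ne', Real.log_mul ha.ne' hb.ne',
      Real.log_mul hN.ne' ht.ne'] at h
    have h2 := mul_le_mul_of_nonneg_left h ht.le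
    have h3 : t * (a * b / (N * t) - 1) = a * b / N - t := by field_simp
    rw [h3] at h2
    linarith

/-- Nonnegativity of mutual information: the entropy of a density on a product dominates the sum
of the entropies of its marginals. -/
theorem entropy_marginals_le [μ.IsOpenPosMeasure] [ν.IsOpenPosMeasure] {f : X × Y → ℝ}
    (hfc : Continuous f) (hf : HasCompactSupport f) (hf0 : ∀ z, 0 ≤ f z) :
    (∫ x, (∫ y, f (x, y) ∂ν) * Real.log (∫ y, f (x, y) ∂ν) ∂μ) +
        (∫ y, (∫ x, f (x, y) ∂μ) * Real.log (∫ x, f (x, y) ∂μ) ∂ν) ≤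
      (∫ z, f z * Real.log (f z) ∂(μ.prod ν)) +
        (∫ z, f z ∂(μ.prod ν)) * Real.log (∫ z, f z ∂(μ.prod ν)) := by
  by_cases hne : f = 0
  · simp [hne]
  set N := ∫ z, f z ∂(μ.prod ν) with hN
  have hNpos : 0 < N := by
    obtain ⟨z, hz⟩ := Function.ne_iff.1 hne
    exact hfc.integral_pos_of_hasCompactSupport_nonneg_nonzero hf hf0 hz
  have hposl : ∀ z, 0 < f z → 0 < ∫ x, f (x, z.2) ∂μ := fun z hz =>
    Continuous.integral_pos_of_hasCompactSupport_nonneg_nonzero (f := fun x => f (x, z.2))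
      (x := z.1) (by fun_prop) (hf.slice_left z.2) (fun x => hf0 _) hz.ne'
  have hposr : ∀ z, 0 < f z → 0 < ∫ y, f (z.1, y) ∂ν := fun z hz =>
    Continuous.integral_pos_of_hasCompactSupport_nonneg_nonzero (f := fun y => f (z.1, y))
      (x := z.2) (by fun_prop) (hf.slice_right z.1) (fun y => hf0 _) hz.ne'
  have hfi : Integrable f (μ.prod ν) := hfc.integrable_of_hasCompactSupport hf
  have hsi : Integrable (fun z : X × Y => f z * Real.log (∫ x, f (x, z.2) ∂μ)) (μ.prod ν) :=
    (integrable_mul_log_marginal (μ := ν) (ν := μ) (f := f ∘ Prod.swap) (hfc.comp continuous_swap)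
      hf.comp_prod_swap (fun z => hf0 _)).swap
  have hs : ∫ z, f z * Real.log (∫ x, f (x, z.2) ∂μ) ∂(μ.prod ν) =
      ∫ y, (∫ x, f (x, y) ∂μ) * Real.log (∫ x, f (x, y) ∂μ) ∂ν := by
    rw [integral_prod_symm _ hsi]
    simp only [integral_mul_const]
  have hFi : Integrable (fun x => ∫ y, f (x, y) ∂ν) μ :=
    (HasCompactSupport.continuous_integral_right hfc hf).integrable_of_hasCompactSupport
      hf.integral_right
  have hGi : Integrable (fun y => ∫ x, f (x, y) ∂μ) ν :=
    (HasCompactSupport.continuous_integral_left hfc hf).integrable_of_hasCompactSupport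
      hf.integral_left
  have hlogi : Integrable (fun z => f z * Real.log (f z)) (μ.prod ν) :=
    (Real.continuous_mul_log.comp hfc).integrable_of_hasCompactSupport hf.mul_log
  have hprod : Integrable
      (fun z : X × Y => (∫ y, f (z.1, y) ∂ν) * (∫ x, f (x, z.2) ∂μ) / N) (μ.prod ν) :=
    (hFi.mul_prod hGi).div_const N
  -- The normalised product of the marginals has the same mass `N` as `f`, so the two correction
  -- terms of the pointwise bound cancel after integration.
  have hval : ∫ z : X × Y, (∫ y, f (z.1, y) ∂ν) * (∫ x, f (x, z.2) ∂μ) / N ∂(μ.prod ν) = N := by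
    rw [integral_div, integral_prod_mul (fun x => ∫ y, f (x, y) ∂ν) (fun y => ∫ x, f (x, y) ∂μ),
      ← integral_prod _ hfi, ← integral_prod_symm _ hfi, ← hN]
    field_simp
  have hmono := integral_mono ((integrable_mul_log_marginal (μ := μ) (ν := ν) hfc hf hf0).add hsi)
    (((hlogi.add (hfi.mul_const (Real.log N))).add hprod).sub hfi) fun z =>
      mul_log_add_mul_log_le (hf0 z) (integral_nonneg fun y => hf0 (z.1, y))
        (integral_nonneg fun x => hf0 (x, z.2)) (hposr z) (hposl z) hNpos
  rw [integral_add' (integrable_mul_log_marginal hfc hf hf0) hsi, hs,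
    integral_mul_log_marginal hfc hf hf0,
    integral_sub' ((hlogi.add (hfi.mul_const (Real.log N))).add hprod) hfi,
    integral_add' (hlogi.add (hfi.mul_const (Real.log N))) hprod,
    integral_add' hlogi (hfi.mul_const (Real.log N)), hval, integral_mul_const, ← hN] at hmono
  linarith

end Marginal

/-! ### Tensorization to `ℝⁿ`. -/

theorem measurePreserving_consEquivL (n : ℕ) :
    MeasurePreserving (Fin.consEquivL ℝ (fun _ : Fin (n + 1) => ℝ))
      ((volume : Measure ℝ).prod volume) volume := by
  have h := (volume_preserving_piFinSuccAbove (fun _ : Fin (n + 1) => ℝ) 0).symm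
  have heq : ⇑(Fin.consEquivL ℝ (fun _ : Fin (n + 1) => ℝ)) =
      ⇑(MeasurableEquiv.piFinSuccAbove (fun _ : Fin (n + 1) => ℝ) 0).symm := by
    funext z
    ext i
    refine Fin.cases ?_ (fun j => ?_) i <;>
      simp [Fin.consEquivL, MeasurableEquiv.piFinSuccAbove, Fin.consLinearEquiv]
  rw [heq]
  exact h

theorem deriv_slice_left {Y : Type*} [NormedAddCommGroup Y] [NormedSpace ℝ Y] {w : ℝ × Y → ℝ}
    (hw : Differentiable ℝ w) (x : ℝ) (y : Y) :
    deriv (fun t => w (t, y)) x = fderiv ℝ w (x, y) (1, 0) := by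
  have h := (hw (x, y)).hasFDerivAt.comp_hasDerivAt x
    ((hasDerivAt_id x).prodMk (hasDerivAt_const x y))
  exact h.deriv

theorem fderiv_slice_right {X Y : Type*} [NormedAddCommGroup X] [NormedSpace ℝ X]
    [NormedAddCommGroup Y] [NormedSpace ℝ Y] {w : X × Y → ℝ}
    (hw : Differentiable ℝ w) (x : X) (y b : Y) :
    fderiv ℝ (fun t => w (x, t)) y b = fderiv ℝ w (x, y) (0, b) := by
  have h := (hw (x, y)).hasFDerivAt.comp y
    ((hasFDerivAt_const x y).prodMk (hasFDerivAt_id y))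
  have h2 : fderiv ℝ (fun t => w (x, t)) y = _ := h.fderiv
  rw [h2]
  simp

/-- Scaled Euclidean logarithmic Sobolev inequality, with one scale per coordinate. -/
theorem entropy_sq_le_fisher_pi : ∀ (n : ℕ) (v : (Fin n → ℝ) → ℝ), ContDiff ℝ 1 v →
    HasCompactSupport v → ∀ l : Fin n → ℝ, (∀ i, 0 < l i) →
    ∫ x, v x ^ 2 * Real.log (v x ^ 2) ≤
      (∫ x, v x ^ 2) * Real.log (∫ x, v x ^ 2) +
        ∑ i, (2 * l i ^ 2 * (∫ x, fderiv ℝ v x (Pi.single i 1) ^ 2) -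
          (∫ x, v x ^ 2) * (1 + Real.log (l i) + Real.log (2 * Real.pi) / 2)) := by
  intro n
  induction n with
  | zero =>
    intro v _ _ l _
    -- In dimension zero the measure is a Dirac mass and both sides agree.
    have h1 : ∀ g : (Fin 0 → ℝ) → ℝ, ∫ x, g x = g default := fun g => by
      rw [volume_pi, Measure.pi_of_empty (x := default), integral_dirac]
    simp [h1]
  | succ n ih =>
    intro v hv hs l hl
    set e := Fin.consEquivL ℝ (fun _ : Fin (n + 1) => ℝ) with he
    have hmp := measurePreserving_consEquivL n
    have hint : ∀ g : (Fin (n + 1) → ℝ) → ℝ,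
        ∫ x, g x = ∫ z : ℝ × (Fin n → ℝ), g (e z) ∂((volume : Measure ℝ).prod volume) := fun g =>
      (hmp.integral_comp e.toHomeomorph.measurableEmbedding g).symm
    set w : ℝ × (Fin n → ℝ) → ℝ := fun z => v (e z) with hw
    have hwd : ContDiff ℝ 1 w := hv.comp e.contDiff
    have hws : HasCompactSupport w := hs.comp_isClosedEmbedding e.toHomeomorph.isClosedEmbedding
    have hwc : Continuous w := hwd.continuous
    have hwdiff : Differentiable ℝ w := hwd.differentiable one_ne_zero
    have hfd : ∀ z b, fderiv ℝ v (e z) (e b) = fderiv ℝ w z b := by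
      intro z b
      have : HasFDerivAt w ((fderiv ℝ v (e z)).comp (e : ℝ × (Fin n → ℝ) →L[ℝ] _)) z :=
        (hv.differentiable one_ne_zero (e z)).hasFDerivAt.comp z e.hasFDerivAt
      rw [this.fderiv]
      rfl
    have he0 : (Pi.single 0 1 : Fin (n + 1) → ℝ) = e (1, 0) := by
      ext i
      refine Fin.cases ?_ (fun j => ?_) i <;> simp [he, Fin.consEquivL, Fin.consLinearEquiv]
    have heS : ∀ j : Fin n, (Pi.single j.succ 1 : Fin (n + 1) → ℝ) = e (0, Pi.single j 1) := by
      intro j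
      ext i
      refine Fin.cases ?_ (fun k => ?_) i
      · simp [he, Fin.consEquivL, Fin.consLinearEquiv]
      · simp [he, Fin.consEquivL, Fin.consLinearEquiv, Pi.single_apply]
    have hfc : Continuous fun z => w z ^ 2 := hwc.pow 2
    have hfs : HasCompactSupport fun z => w z ^ 2 := by
      simp only [pow_two]
      exact hws.mul_right
    have hlogc : Continuous fun z => w z ^ 2 * Real.log (w z ^ 2) :=
      Real.continuous_mul_log.comp hfc
    have hlogi := hlogc.integrable_of_hasCompactSupport (μ := (volume : Measure ℝ).prod volume)
      hfs.mul_log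
    have hfi := hfc.integrable_of_hasCompactSupport (μ := (volume : Measure ℝ).prod volume) hfs
    have hdc : ∀ b, Continuous fun z => fderiv ℝ w z b ^ 2 := fun b =>
      ((hwd.continuous_fderiv one_ne_zero).clm_apply continuous_const).pow 2
    have hds : ∀ b, HasCompactSupport fun z => fderiv ℝ w z b ^ 2 := fun b =>
      (hws.fderiv ℝ).comp_left (g := fun L : ℝ × (Fin n → ℝ) →L[ℝ] ℝ => L b ^ 2) (by simp)
    have hdi := fun b => (hdc b).integrable_of_hasCompactSupport
      (μ := (volume : Measure ℝ).prod volume) (hds b)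
    have hFc := HasCompactSupport.continuous_integral_left (μ := volume) hfc hfs
    have hGc := HasCompactSupport.continuous_integral_right (ν := volume) hfc hfs
    have hFlog : Integrable fun y => (∫ x, w (x, y) ^ 2) * Real.log (∫ x, w (x, y) ^ 2) := (Real.continuous_mul_log.comp hFc).integrable_of_hasCompactSupport
      (μ := volume) hfs.integral_left.mul_log
    have hGlog : Integrable fun x => (∫ y, w (x, y) ^ 2) * Real.log (∫ y, w (x, y) ^ 2) := (Real.continuous_mul_log.comp hGc).integrable_of_hasCompactSupport
      (μ := volume) hfs.integral_right.mul_log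
    -- The one-dimensional inequality on each slice in the first variable, integrated over the
    -- others, leaves the entropy of a marginal.
    have h1 : ∫ z, w z ^ 2 * Real.log (w z ^ 2) ∂((volume : Measure ℝ).prod volume) ≤
        (∫ y, (∫ x, w (x, y) ^ 2) * Real.log (∫ x, w (x, y) ^ 2)) +
          2 * l 0 ^ 2 * (∫ z, fderiv ℝ w z (1, 0) ^ 2 ∂((volume : Measure ℝ).prod volume)) -
          (∫ z, w z ^ 2 ∂((volume : Measure ℝ).prod volume)) *
            (1 + Real.log (l 0) + Real.log (2 * Real.pi) / 2) := by
      have hsumi : Integrable fun y => (∫ x, w (x, y) ^ 2) * Real.log (∫ x, w (x, y) ^ 2) +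
          2 * l 0 ^ 2 * ∫ x, fderiv ℝ w (x, y) (1, 0) ^ 2 :=
        hFlog.add ((hdi (1, 0)).integral_prod_right.const_mul _)
      rw [integral_prod_symm _ hlogi, integral_prod_symm _ hfi, integral_prod_symm _ (hdi _),
        ← integral_const_mul, ← integral_mul_const, ← integral_add hFlog
          ((hdi (1, 0)).integral_prod_right.const_mul _), ← integral_sub hsumi
          (hfi.integral_prod_right.mul_const _)]
      refine integral_mono hlogi.integral_prod_right
        (hsumi.sub (hfi.integral_prod_right.mul_const _)) fun y => ?_
      have := entropy_sq_le_fisher_real (v := fun x => w (x, y)) (by fun_prop)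
        (hws.slice_left y) (hl 0)
      simpa only [deriv_slice_left hwdiff] using this
    -- The induction hypothesis on the complementary slices leaves the entropy of the other
    -- marginal.
    have h2 : ∫ z, w z ^ 2 * Real.log (w z ^ 2) ∂((volume : Measure ℝ).prod volume) ≤
        (∫ x, (∫ y, w (x, y) ^ 2) * Real.log (∫ y, w (x, y) ^ 2)) +
          ∑ i : Fin n, (2 * l i.succ ^ 2 *
            (∫ z, fderiv ℝ w z (0, Pi.single i 1) ^ 2 ∂((volume : Measure ℝ).prod volume)) -
          (∫ z, w z ^ 2 ∂((volume : Measure ℝ).prod volume)) *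
            (1 + Real.log (l i.succ) + Real.log (2 * Real.pi) / 2)) := by
      have hti : ∀ i ∈ (Finset.univ : Finset (Fin n)), Integrable fun x : ℝ =>
          2 * l i.succ ^ 2 * (∫ y, fderiv ℝ w (x, y) (0, Pi.single i 1) ^ 2) -
            (∫ y, w (x, y) ^ 2) * (1 + Real.log (l i.succ) + Real.log (2 * Real.pi) / 2) :=
        fun i _ => ((hdi (0, Pi.single i 1)).integral_prod_left.const_mul _).sub
          (hfi.integral_prod_left.mul_const _)
      have hsum : ∑ i : Fin n, (2 * l i.succ ^ 2 *
            (∫ z, fderiv ℝ w z (0, Pi.single i 1) ^ 2 ∂((volume : Measure ℝ).prod volume)) -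
          (∫ z, w z ^ 2 ∂((volume : Measure ℝ).prod volume)) *
            (1 + Real.log (l i.succ) + Real.log (2 * Real.pi) / 2)) =
          ∫ x, ∑ i : Fin n, (2 * l i.succ ^ 2 *
              (∫ y, fderiv ℝ w (x, y) (0, Pi.single i 1) ^ 2) -
            (∫ y, w (x, y) ^ 2) * (1 + Real.log (l i.succ) + Real.log (2 * Real.pi) / 2)) := by
        rw [integral_finsetSum _ hti]
        refine Finset.sum_congr rfl fun i _ => ?_
        rw [integral_prod _ hfi, integral_prod _ (hdi _), ← integral_const_mul,
          ← integral_mul_const, integral_sub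
            ((hdi (0, Pi.single i 1)).integral_prod_left.const_mul _)
            (hfi.integral_prod_left.mul_const _)]
      rw [hsum, integral_prod _ hlogi, ← integral_add hGlog (integrable_finsetSum _ hti)]
      refine integral_mono hlogi.integral_prod_left
        (hGlog.add (integrable_finsetSum _ hti)) fun x => ?_
      have := ih (fun y => w (x, y)) (by fun_prop) (hws.slice_right x)
        (fun i => l i.succ) fun i => hl _
      simpa only [fderiv_slice_right hwdiff] using this
    -- Adding `h1` and `h2` bounds twice the joint entropy; `h3` bounds the marginal entropies by
    -- one copy of it plus `N log N`, and that copy cancels.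
    have h3 := entropy_marginals_le (μ := (volume : Measure ℝ))
      (ν := (volume : Measure (Fin n → ℝ))) hfc hfs fun z => sq_nonneg (w z)
    rw [Fin.sum_univ_succ]
    simp only [hint, he0, heS, hfd]
    linarith

/-! ### The Gaussian density and integration by parts. -/

/-- Density of the standard Gaussian measure on a Euclidean space. -/
noncomputable def stdGaussianDensity (E : Type*) [NormedAddCommGroup E] [InnerProductSpace ℝ E]
    (x : E) : ℝ :=
  (2 * Real.pi) ^ (-(Module.finrank ℝ E / 2 : ℝ)) * Real.exp (-(1 / 2) * ‖x‖ ^ 2)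

section Density

variable {E : Type*} [NormedAddCommGroup E] [InnerProductSpace ℝ E]

theorem stdGaussianDensity_pos (x : E) : 0 < stdGaussianDensity E x := by
  unfold stdGaussianDensity; positivity

theorem log_stdGaussianDensity (x : E) : Real.log (stdGaussianDensity E x) =
    -(Module.finrank ℝ E / 2 * Real.log (2 * Real.pi)) - ‖x‖ ^ 2 / 2 := by
  unfold stdGaussianDensity
  rw [Real.log_mul (by positivity) (by positivity), Real.log_exp, Real.log_rpow (by positivity)]
  ring

theorem contDiff_stdGaussianDensity {m : WithTop ℕ∞} : ContDiff ℝ m (stdGaussianDensity E) := by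
  unfold stdGaussianDensity
  exact contDiff_const.mul (contDiff_const.mul (contDiff_norm_sq ℝ)).exp

theorem hasFDerivAt_stdGaussianDensity (x : E) :
    HasFDerivAt (stdGaussianDensity E) (-(stdGaussianDensity E x) • innerSL ℝ x) x := by
  have h := ((((hasStrictFDerivAt_norm_sq x).hasFDerivAt.const_mul (-(1 / 2) : ℝ)).exp).const_mul
    ((2 * Real.pi) ^ (-(Module.finrank ℝ E / 2 : ℝ))))
  convert! h using 1
  unfold stdGaussianDensity
  ext y
  simp
  ring

variable [FiniteDimensional ℝ E] [MeasurableSpace E] [BorelSpace E]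

theorem integrable_stdGaussianDensity : Integrable (stdGaussianDensity E) := by
  unfold stdGaussianDensity
  have h := (GaussianFourier.integrable_cexp_neg_mul_sq_norm_add (V := E) (b := 1 / 2)
    (by norm_num) 0 0).norm.const_mul ((2 * Real.pi) ^ (-(Module.finrank ℝ E / 2 : ℝ)))
  convert h using 3 with x
  rw [Complex.norm_exp]
  simp [← Complex.ofReal_pow]

/-- Both measures are finite and have the same characteristic function. -/
theorem stdGaussian_eq_withDensity :
    stdGaussian E = volume.withDensity fun x => ENNReal.ofReal (stdGaussianDensity E x) := by
  have : IsFiniteMeasure (volume.withDensity fun x : E =>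
      ENNReal.ofReal (stdGaussianDensity E x)) :=
    isFiniteMeasure_withDensity_ofReal integrable_stdGaussianDensity.2
  apply Measure.ext_of_charFun
  funext t
  rw [charFun_stdGaussian, charFun_apply, integral_withDensity_eq_integral_toReal_smul
    (contDiff_stdGaussianDensity (m := 0)).continuous.measurable.ennreal_ofReal (by simp)]
  have hx : ∀ x : E, (ENNReal.ofReal (stdGaussianDensity E x)).toReal •
      Complex.exp (inner ℝ x t * Complex.I) =
      ((2 * Real.pi) ^ (-(Module.finrank ℝ E / 2 : ℝ)) : ℝ) *
        Complex.exp (-(1 / 2 : ℂ) * ‖x‖ ^ 2 + Complex.I * (inner ℝ t x : ℝ)) := by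
    intro x
    rw [ENNReal.toReal_ofReal (stdGaussianDensity_pos x).le, stdGaussianDensity,
      Complex.real_smul, Complex.exp_add, real_inner_comm]
    push_cast
    ring_nf
  simp_rw [hx]
  rw [integral_const_mul, GaussianFourier.integral_cexp_neg_mul_sq_norm_add (by norm_num)]
  rw [← mul_assoc]
  have h1 : (((2 * Real.pi) ^ (-(Module.finrank ℝ E / 2 : ℝ)) : ℝ) : ℂ) *
      ((Real.pi : ℂ) / (1 / 2)) ^ ((Module.finrank ℝ E : ℂ) / 2) = 1 := by
    have : ((Real.pi : ℂ) / (1 / 2)) ^ ((Module.finrank ℝ E : ℂ) / 2) =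
        (((2 * Real.pi) ^ (Module.finrank ℝ E / 2 : ℝ) : ℝ) : ℂ) := by
      rw [Complex.ofReal_cpow (by positivity)]
      push_cast
      congr 1
      ring
    rw [this, ← Complex.ofReal_mul, ← Real.rpow_add (by positivity)]
    simp
  rw [h1, one_mul]
  congr 1
  rw [Complex.I_sq]
  ring

theorem integral_stdGaussian (f : E → ℝ) :
    ∫ x, f x ∂(stdGaussian E) = ∫ x, stdGaussianDensity E x * f x := by
  rw [stdGaussian_eq_withDensity, integral_withDensity_eq_integral_toReal_smul
    (contDiff_stdGaussianDensity (m := 0)).continuous.measurable.ennreal_ofReal (by simp)]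
  simp [ENNReal.toReal_ofReal (stdGaussianDensity_pos _).le]

/-- Gaussian integration by parts. -/
theorem integral_fderiv_stdGaussian {f : E → ℝ} (hf : ContDiff ℝ 1 f) (hs : HasCompactSupport f)
    (b : E) :
    ∫ x, fderiv ℝ f x b ∂(stdGaussian E) = ∫ x, inner ℝ x b * f x ∂(stdGaussian E) := by
  have hg := contDiff_stdGaussianDensity (E := E) (m := 1)
  have hgc := hg.continuous
  have hfc := hf.continuous
  have hf'c : Continuous fun x => fderiv ℝ f x b :=
    (hf.continuous_fderiv one_ne_zero).clm_apply continuous_const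
  have hf's : HasCompactSupport fun x => fderiv ℝ f x b :=
    (hs.fderiv ℝ).comp_left (g := fun L : E →L[ℝ] ℝ => L b) (by simp)
  have hg'c : Continuous fun x => fderiv ℝ (stdGaussianDensity E) x b :=
    (hg.continuous_fderiv one_ne_zero).clm_apply continuous_const
  rw [integral_stdGaussian, integral_stdGaussian, integral_mul_fderiv_eq_neg_fderiv_mul_of_integrable,
    ← integral_neg]
  · refine integral_congr_ae (Filter.Eventually.of_forall fun x => ?_)
    simp only [(hasFDerivAt_stdGaussianDensity x).fderiv]
    simp
    ring
  · exact (hg'c.mul hfc).integrable_of_hasCompactSupport hs.mul_left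
  · exact (hgc.mul hf'c).integrable_of_hasCompactSupport hf's.mul_left
  · exact (hgc.mul hfc).integrable_of_hasCompactSupport hs.mul_left
  · exact fun x _ => hg.differentiable one_ne_zero x
  · exact fun x _ => hf.differentiable one_ne_zero x

end Density

/-! ### From Lebesgue to Gaussian entropy, and Jensen's inequality. -/

section Entropy

variable {E : Type*} [NormedAddCommGroup E] [InnerProductSpace ℝ E] [FiniteDimensional ℝ E]
  [MeasurableSpace E] [BorelSpace E] {n : ℕ}

/-- Scaled Euclidean logarithmic Sobolev inequality in an orthonormal basis. -/
theorem entropy_sq_le_fisher_orthonormalBasis (b : OrthonormalBasis (Fin n) ℝ E) {v : E → ℝ}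
    (hv : ContDiff ℝ 1 v) (hs : HasCompactSupport v) {l : Fin n → ℝ} (hl : ∀ i, 0 < l i) :
    ∫ x, v x ^ 2 * Real.log (v x ^ 2) ≤
      (∫ x, v x ^ 2) * Real.log (∫ x, v x ^ 2) +
        ∑ i, (2 * l i ^ 2 * (∫ x, fderiv ℝ v x (b i) ^ 2) -
          (∫ x, v x ^ 2) * (1 + Real.log (l i) + Real.log (2 * Real.pi) / 2)) := by
  set e : (Fin n → ℝ) ≃L[ℝ] E := (EuclideanSpace.equiv (Fin n) ℝ).symm.trans
    b.repr.symm.toContinuousLinearEquiv with he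
  have hmp : MeasurePreserving e := b.measurePreserving_repr_symm.comp
    (PiLp.volume_preserving_toLp (Fin n))
  have hint : ∀ g : E → ℝ, ∫ x, g x = ∫ y, g (e y) := fun g =>
    (hmp.integral_comp e.toHomeomorph.measurableEmbedding g).symm
  have heb : ∀ i, b i = e (Pi.single i 1) := fun i => by
    simp [he]
  have hfd : ∀ y c, fderiv ℝ v (e y) (e c) = fderiv ℝ (fun y => v (e y)) y c := by
    intro y c
    have : HasFDerivAt (fun y => v (e y)) ((fderiv ℝ v (e y)).comp (e : (Fin n → ℝ) →L[ℝ] E)) y :=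
      (hv.differentiable one_ne_zero (e y)).hasFDerivAt.comp y e.hasFDerivAt
    rw [this.fderiv]
    rfl
  simp only [hint, heb, hfd]
  exact entropy_sq_le_fisher_pi n (fun y => v (e y)) (hv.comp e.contDiff)
    (hs.comp_isClosedEmbedding e.toHomeomorph.isClosedEmbedding) l hl

theorem integrable_stdGaussian_of_hasCompactSupport {f : E → ℝ} (hf : Continuous f)
    (hs : HasCompactSupport f) : Integrable f (stdGaussian E) :=
  hf.integrable_of_hasCompactSupport hs

/-- Directional Fisher information of `u² g`, with `g` the Gaussian density. -/
theorem integral_fderiv_mul_sqrt_density_sq {u : E → ℝ} (hu : ContDiff ℝ 1 u)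
    (hs : HasCompactSupport u) (b : E) :
    ∫ x, fderiv ℝ (fun x => u x * √(stdGaussianDensity E x)) x b ^ 2 =
      (∫ x, fderiv ℝ u x b ^ 2 ∂(stdGaussian E)) +
        ‖b‖ ^ 2 / 2 * (∫ x, u x ^ 2 ∂(stdGaussian E)) -
        (∫ x, inner ℝ x b ^ 2 * u x ^ 2 ∂(stdGaussian E)) / 4 := by
  have huc := hu.continuous
  have hudiff := hu.differentiable one_ne_zero
  have hdc : Continuous fun x => fderiv ℝ u x b :=
    (hu.continuous_fderiv one_ne_zero).clm_apply continuous_const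
  have hds : HasCompactSupport fun x => fderiv ℝ u x b :=
    (hs.fderiv ℝ).comp_left (g := fun L : E →L[ℝ] ℝ => L b) (by simp)
  have hpt : ∀ x, fderiv ℝ (fun x => u x * √(stdGaussianDensity E x)) x b ^ 2 =
      stdGaussianDensity E x * (fderiv ℝ u x b - inner ℝ x b * u x / 2) ^ 2 := by
    intro x
    have hg := stdGaussianDensity_pos x
    have hr := (hudiff x).hasFDerivAt.mul ((hasFDerivAt_stdGaussianDensity x).sqrt hg.ne')
    have hr' : fderiv ℝ (fun x => u x * √(stdGaussianDensity E x)) x = _ := hr.fderiv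
    rw [hr']
    have hsq := Real.sq_sqrt hg.le
    have hpos := Real.sqrt_pos.2 hg
    set r := √(stdGaussianDensity E x)
    rw [← hsq]
    simp only [add_apply, smul_apply, smul_eq_mul,
      innerSL_apply_apply]
    field_simp
    ring
  have hf1 : ContDiff ℝ 1 fun x => inner ℝ x b * u x ^ 2 :=
    (contDiff_id.inner ℝ contDiff_const).mul (hu.pow 2)
  have hu2s : HasCompactSupport fun x => u x ^ 2 := by
    simp only [pow_two]
    exact hs.mul_right
  have hfd : ∀ x, fderiv ℝ (fun x => inner ℝ x b * u x ^ 2) x b =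
      ‖b‖ ^ 2 * u x ^ 2 + 2 * (inner ℝ x b * u x * fderiv ℝ u x b) := by
    intro x
    have hb : HasFDerivAt (fun x : E => inner ℝ x b) (innerSL ℝ b : E →L[ℝ] ℝ) x := by
      have : (fun x : E => inner ℝ x b) = innerSL ℝ b := by
        funext x
        simp [real_inner_comm]
      rw [this]
      exact (innerSL ℝ b : E →L[ℝ] ℝ).hasFDerivAt
    have h := hb.mul ((hudiff x).hasFDerivAt.pow 2)
    have h' : fderiv ℝ (fun x => inner ℝ x b * u x ^ 2) x = _ := h.fderiv
    rw [h']
    simp [real_inner_comm]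
    ring
  -- Integrating `⟨x, b⟩ u²` by parts evaluates the cross term `∫ ⟨x, b⟩ u ∂_b u dγ` that appears
  -- when the square is expanded.
  have hibp := integral_fderiv_stdGaussian hf1 hu2s.mul_left b
  simp only [hfd] at hibp
  have hic : Continuous fun x : E => inner ℝ x b := by fun_prop
  have i1 : Integrable (fun x => u x ^ 2) (stdGaussian E) :=
    integrable_stdGaussian_of_hasCompactSupport (huc.pow 2) hu2s
  have i2 : Integrable (fun x => inner ℝ x b * u x * fderiv ℝ u x b) (stdGaussian E) :=
    integrable_stdGaussian_of_hasCompactSupport ((hic.mul huc).mul hdc) hds.mul_left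
  have i3 : Integrable (fun x => inner ℝ x b ^ 2 * u x ^ 2) (stdGaussian E) :=
    integrable_stdGaussian_of_hasCompactSupport ((hic.pow 2).mul (huc.pow 2)) hu2s.mul_left
  have i4 : Integrable (fun x => fderiv ℝ u x b ^ 2) (stdGaussian E) := by
    refine integrable_stdGaussian_of_hasCompactSupport (hdc.pow 2) ?_
    simp only [pow_two]
    exact hds.mul_right
  rw [integral_add (i1.const_mul _) (i2.const_mul _), integral_const_mul, integral_const_mul]
    at hibp
  have h3 : ∫ x, inner ℝ x b * (inner ℝ x b * u x ^ 2) ∂(stdGaussian E) =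
      ∫ x, inner ℝ x b ^ 2 * u x ^ 2 ∂(stdGaussian E) := by
    congr 1
    funext x
    ring
  rw [h3] at hibp
  simp only [hpt]
  rw [← integral_stdGaussian fun x => (fderiv ℝ u x b - inner ℝ x b * u x / 2) ^ 2]
  have h4 : ∀ x, (fderiv ℝ u x b - inner ℝ x b * u x / 2) ^ 2 =
      fderiv ℝ u x b ^ 2 - inner ℝ x b * u x * fderiv ℝ u x b +
        1 / 4 * (inner ℝ x b ^ 2 * u x ^ 2) := fun x => by ring
  simp only [h4]
  have i5 : Integrable (fun x => fderiv ℝ u x b ^ 2 - inner ℝ x b * u x * fderiv ℝ u x b)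
      (stdGaussian E) := i4.sub i2
  rw [integral_add i5 (i3.const_mul _), integral_sub i4 i2, integral_const_mul]
  linarith

/-- Gaussian logarithmic Sobolev inequality with one scale per direction, for isotropic
densities `u²`. -/
theorem gaussian_entropy_sq_le_of_isotropic (b : OrthonormalBasis (Fin n) ℝ E) {u : E → ℝ}
    (hu : ContDiff ℝ 1 u) (hs : HasCompactSupport u)
    (hiso : ∀ i, ∫ x, inner ℝ x (b i) ^ 2 * u x ^ 2 ∂(stdGaussian E) =
      ∫ x, u x ^ 2 ∂(stdGaussian E)) {l : Fin n → ℝ} (hl : ∀ i, 0 < l i) :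
    ∫ x, u x ^ 2 * Real.log (u x ^ 2) ∂(stdGaussian E) ≤
      (∫ x, u x ^ 2 ∂(stdGaussian E)) * Real.log (∫ x, u x ^ 2 ∂(stdGaussian E)) +
        ∑ i, (2 * l i ^ 2 * ((∫ x, fderiv ℝ u x (b i) ^ 2 ∂(stdGaussian E)) +
            (∫ x, u x ^ 2 ∂(stdGaussian E)) / 4) -
          (∫ x, u x ^ 2 ∂(stdGaussian E)) * (1 / 2 + Real.log (l i))) := by
  have huc := hu.continuous
  have hu2s : HasCompactSupport fun x => u x ^ 2 := by
    simp only [pow_two]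
    exact hs.mul_right
  have hv : ContDiff ℝ 1 fun x => u x * √(stdGaussianDensity E x) :=
    hu.mul (contDiff_stdGaussianDensity.sqrt fun x => (stdGaussianDensity_pos x).ne')
  have hmain := entropy_sq_le_fisher_orthonormalBasis b hv hs.mul_right hl
  have hsq : ∀ x, (u x * √(stdGaussianDensity E x)) ^ 2 = stdGaussianDensity E x * u x ^ 2 := by
    intro x
    rw [mul_pow, Real.sq_sqrt (stdGaussianDensity_pos x).le, mul_comm]
  -- Splitting `|x|²` along the basis lets isotropy evaluate the Gaussian exponent one direction at
  -- a time.
  have hlog : ∀ x, stdGaussianDensity E x * u x ^ 2 * Real.log (stdGaussianDensity E x * u x ^ 2) =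
      stdGaussianDensity E x * (u x ^ 2 * Real.log (u x ^ 2) -
        n / 2 * Real.log (2 * Real.pi) * u x ^ 2 -
          1 / 2 * ∑ i, inner ℝ x (b i) ^ 2 * u x ^ 2) := by
    intro x
    rcases eq_or_ne (u x) 0 with h0 | h0
    · simp [h0]
    · rw [Real.log_mul (stdGaussianDensity_pos x).ne' (pow_ne_zero 2 h0), log_stdGaussianDensity,
        ← Finset.sum_mul, ← b.sum_sq_inner_left, Module.finrank_eq_card_basis b.toBasis,
        Fintype.card_fin]
      ring
  simp only [hsq, hlog, integral_fderiv_mul_sqrt_density_sq hu hs, hiso, b.norm_eq_one] at hmain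
  rw [← integral_stdGaussian fun x => u x ^ 2, ← integral_stdGaussian fun x =>
    u x ^ 2 * Real.log (u x ^ 2) - n / 2 * Real.log (2 * Real.pi) * u x ^ 2 -
      1 / 2 * ∑ i, inner ℝ x (b i) ^ 2 * u x ^ 2] at hmain
  have i1 : Integrable (fun x => u x ^ 2) (stdGaussian E) :=
    integrable_stdGaussian_of_hasCompactSupport (huc.pow 2) hu2s
  have i2 : Integrable (fun x => u x ^ 2 * Real.log (u x ^ 2)) (stdGaussian E) :=
    integrable_stdGaussian_of_hasCompactSupport (Real.continuous_mul_log.comp (huc.pow 2))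
      hu2s.mul_log
  have i3 : ∀ i ∈ Finset.univ,
      Integrable (fun x => inner ℝ x (b i) ^ 2 * u x ^ 2) (stdGaussian E) := fun i _ =>
    integrable_stdGaussian_of_hasCompactSupport
      (((by fun_prop : Continuous fun x : E => inner ℝ x (b i)).pow 2).mul (huc.pow 2))
      hu2s.mul_left
  have i4 : Integrable (fun x => u x ^ 2 * Real.log (u x ^ 2) -
      n / 2 * Real.log (2 * Real.pi) * u x ^ 2) (stdGaussian E) := i2.sub (i1.const_mul _)
  rw [integral_sub i4 ((integrable_finsetSum _ i3).const_mul _),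
    integral_sub i2 (i1.const_mul _), integral_const_mul, integral_const_mul,
    integral_finsetSum _ i3] at hmain
  simp only [hiso, Finset.sum_const, Finset.card_univ, Fintype.card_fin, nsmul_eq_mul,
    Finset.sum_sub_distrib, mul_add, Finset.sum_add_distrib] at hmain ⊢
  have hsplit : ∑ i, 2 * l i ^ 2 * ((∫ x, fderiv ℝ u x (b i) ^ 2 ∂(stdGaussian E)) +
        1 ^ 2 / 2 * (∫ x, u x ^ 2 ∂(stdGaussian E)) - (∫ x, u x ^ 2 ∂(stdGaussian E)) / 4) =
      ∑ i, 2 * l i ^ 2 * (∫ x, fderiv ℝ u x (b i) ^ 2 ∂(stdGaussian E)) +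
        ∑ i, 2 * l i ^ 2 * ((∫ x, u x ^ 2 ∂(stdGaussian E)) / 4) := by
    rw [← Finset.sum_add_distrib]
    exact Finset.sum_congr rfl fun i _ => by ring
  rw [hsplit] at hmain
  linarith

/-- With `D i = 4 K i / N + 1`, each summand is `(N/2) l² D i - N(1/2 + log l)`, minimised at `l = D
i ^ (-1/2)` with value `(N/2) log (D i)`. -/
theorem gaussian_entropy_sq_le_sum_log (b : OrthonormalBasis (Fin n) ℝ E) {u : E → ℝ}
    (hu : ContDiff ℝ 1 u) (hs : HasCompactSupport u)
    (hiso : ∀ i, ∫ x, inner ℝ x (b i) ^ 2 * u x ^ 2 ∂(stdGaussian E) =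
      ∫ x, u x ^ 2 ∂(stdGaussian E)) (hpos : 0 < ∫ x, u x ^ 2 ∂(stdGaussian E)) :
    ∫ x, u x ^ 2 * Real.log (u x ^ 2) ∂(stdGaussian E) ≤
      (∫ x, u x ^ 2 ∂(stdGaussian E)) * Real.log (∫ x, u x ^ 2 ∂(stdGaussian E)) +
        (∫ x, u x ^ 2 ∂(stdGaussian E)) / 2 * ∑ i,
          Real.log (4 / (∫ x, u x ^ 2 ∂(stdGaussian E)) *
            (∫ x, fderiv ℝ u x (b i) ^ 2 ∂(stdGaussian E)) + 1) := by
  set N := ∫ x, u x ^ 2 ∂(stdGaussian E) with hN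
  set K : Fin n → ℝ := fun i => ∫ x, fderiv ℝ u x (b i) ^ 2 ∂(stdGaussian E) with hK
  have hD : ∀ i, 0 < 4 / N * K i + 1 := fun i => by
    have : 0 ≤ K i := integral_nonneg fun x => sq_nonneg _
    positivity
  have h := gaussian_entropy_sq_le_of_isotropic b hu hs hiso
    (l := fun i => (√(4 / N * K i + 1))⁻¹) fun i => inv_pos.2 (Real.sqrt_pos.2 (hD i))
  refine h.trans_eq ?_
  rw [Finset.mul_sum]
  congr 1
  refine Finset.sum_congr rfl fun i _ => ?_
  change 2 * (√(4 / N * K i + 1))⁻¹ ^ 2 * (K i + N / 4) -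
    N * (1 / 2 + Real.log (√(4 / N * K i + 1))⁻¹) = N / 2 * Real.log (4 / N * K i + 1)
  rw [inv_pow, Real.sq_sqrt (hD i).le, Real.log_inv, Real.log_sqrt (hD i).le]
  have h1 : K i + N / 4 = N / 4 * (4 / N * K i + 1) := by field_simp
  rw [h1]
  have := (hD i).ne'
  generalize 4 / N * K i + 1 = D at this
  field_simp
  ring

/-- Jensen's inequality for `|u|^(p-2)` under the density `u²`. -/
theorem integral_rpow_ge_exp_entropy {α : Type*} [MeasurableSpace α] {μ : Measure α} {u : α → ℝ}
    {p : ℝ} (hp : 0 < p) (h2 : Integrable (fun x => u x ^ 2) μ)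
    (hlog : Integrable (fun x => u x ^ 2 * Real.log (u x ^ 2)) μ)
    (hpi : Integrable (fun x => |u x| ^ p) μ) (hpos : 0 < ∫ x, u x ^ 2 ∂μ) :
    (∫ x, u x ^ 2 ∂μ) * Real.exp ((p - 2) / 2 *
      ((∫ x, u x ^ 2 * Real.log (u x ^ 2) ∂μ) / ∫ x, u x ^ 2 ∂μ)) ≤ ∫ x, |u x| ^ p ∂μ := by
  set N := ∫ x, u x ^ 2 ∂μ with hN
  set H := ∫ x, u x ^ 2 * Real.log (u x ^ 2) ∂μ with hH
  set m := (p - 2) / 2 * (H / N) with hm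
  -- Tangent line of `exp` at `m`, the mean of `(p - 2) log |u|` under `u²/N`; integrating it leaves
  -- exactly `N exp m`.
  have hpt : ∀ x, Real.exp m * ((1 - m) * u x ^ 2 +
      (p - 2) / 2 * (u x ^ 2 * Real.log (u x ^ 2))) ≤ |u x| ^ p := by
    intro x
    rcases eq_or_ne (u x) 0 with h0 | h0
    · simp [h0, Real.zero_rpow hp.ne']
    · have ha : 0 < |u x| := abs_pos.2 h0
      have hl : Real.log (u x ^ 2) = 2 * Real.log |u x| := by
        rw [← sq_abs, Real.log_pow]; norm_num
      have h3 : |u x| ^ p = u x ^ 2 * (Real.exp m * Real.exp ((p - 2) * Real.log |u x| - m)) := by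
        rw [← Real.exp_add, ← sq_abs, Real.rpow_def_of_pos ha,
          ← Real.exp_log (pow_pos ha 2), ← Real.exp_add, Real.log_pow]
        congr 1
        push_cast
        ring
      have h4 := Real.add_one_le_exp ((p - 2) * Real.log |u x| - m)
      rw [h3, hl]
      calc _ = u x ^ 2 * (Real.exp m * ((p - 2) * Real.log |u x| - m + 1)) := by ring
        _ ≤ _ := by gcongr
  have hint := integral_mono (((h2.const_mul (1 - m)).add (hlog.const_mul ((p - 2) / 2))).const_mul
    (Real.exp m)) hpi hpt
  refine le_trans (le_of_eq ?_) hint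
  simp only [Pi.add_apply]
  rw [integral_const_mul, integral_add (h2.const_mul _) (hlog.const_mul _), integral_const_mul,
    integral_const_mul, ← hN, ← hH]
  have : (1 - m) * N + (p - 2) / 2 * H = N := by
    rw [hm]; field_simp; ring
  rw [this]
  ring

end Entropy

/-! ### Norms as integrals, the determinant bound and the conclusion. -/

theorem gaussianLpNorm_eq {n : ℕ} {u : EuclideanSpace ℝ (Fin n) → ℝ} (hu : Continuous u)
    (hs : HasCompactSupport u) {p : ℝ} (hp : 0 < p) : gaussianLpNorm n p u =
      (∫ x, |u x| ^ p ∂(stdGaussian (EuclideanSpace ℝ (Fin n)))) ^ p⁻¹ := by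
  have hm : MemLp u (ENNReal.ofReal p) (stdGaussian (EuclideanSpace ℝ (Fin n))) :=
    hu.memLp_of_hasCompactSupport hs
  rw [gaussianLpNorm, hm.eLpNorm_eq_integral_rpow_norm (by simpa using hp) ENNReal.ofReal_ne_top,
    ENNReal.toReal_ofReal hp.le, ENNReal.toReal_ofReal]
  · simp only [Real.norm_eq_abs]
  · exact Real.rpow_nonneg (integral_nonneg fun x => by positivity) _

theorem gaussianLpNorm_two_sq {n : ℕ} {u : EuclideanSpace ℝ (Fin n) → ℝ} (hu : Continuous u)
    (hs : HasCompactSupport u) : gaussianLpNorm n 2 u ^ 2 =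
      ∫ x, u x ^ 2 ∂(stdGaussian (EuclideanSpace ℝ (Fin n))) := by
  have h0 : 0 ≤ ∫ x, |u x| ^ (2 : ℝ) ∂(stdGaussian (EuclideanSpace ℝ (Fin n))) :=
    integral_nonneg fun x => by positivity
  rw [gaussianLpNorm_eq hu hs two_pos, ← Real.rpow_natCast, ← Real.rpow_mul h0]
  simp

/-- Expansion of the second moments of a vector field in a direction `b`. -/
theorem integral_inner_sq_mul_eq_sum {n : ℕ} {α : Type*} [MeasurableSpace α] {μ : Measure α}
    (X : α → EuclideanSpace ℝ (Fin n)) (f : α → ℝ)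
    (hi : ∀ i j, Integrable (fun x => X x i * X x j * f x) μ) (b : EuclideanSpace ℝ (Fin n)) :
    ∫ x, inner ℝ (X x) b ^ 2 * f x ∂μ =
      ∑ i, b i * ∑ j, (∫ x, X x i * X x j * f x ∂μ) * b j := by
  have hpt : ∀ x, inner ℝ (X x) b ^ 2 * f x =
      ∑ i, ∑ j, b i * b j * (X x i * X x j * f x) := by
    intro x
    rw [PiLp.inner_apply, pow_two, Finset.sum_mul_sum, Finset.sum_mul]
    refine Finset.sum_congr rfl fun i _ => ?_
    rw [Finset.sum_mul]
    refine Finset.sum_congr rfl fun j _ => ?_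
    simp
    ring
  simp only [hpt]
  rw [integral_finsetSum _ fun i _ => integrable_finsetSum _ fun j _ => (hi i j).const_mul _]
  refine Finset.sum_congr rfl fun i _ => ?_
  rw [integral_finsetSum _ fun j _ => (hi i j).const_mul _, Finset.mul_sum]
  refine Finset.sum_congr rfl fun j _ => ?_
  rw [integral_const_mul]
  ring

/-- Dimensional Gaussian logarithmic Sobolev inequality for isotropic densities `u²`. -/
theorem gaussian_entropy_sq_le_log_det {n : ℕ} {u : EuclideanSpace ℝ (Fin n) → ℝ}
    (hu : ContDiff ℝ 1 u) (hs : HasCompactSupport u)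
    {N : ℝ} (hN : N = ∫ x, u x ^ 2 ∂(stdGaussian (EuclideanSpace ℝ (Fin n)))) (hpos : 0 < N)
    (hiso : ∀ i j : Fin n, ∫ x, x i * x j * u x ^ 2 ∂(stdGaussian (EuclideanSpace ℝ (Fin n)))
        = if i = j then N else 0) :
    0 < ((4 / N) • gaussianGradientMatrix n u + 1).det ∧
    ∫ x, u x ^ 2 * Real.log (u x ^ 2) ∂(stdGaussian (EuclideanSpace ℝ (Fin n))) ≤
      N * Real.log N + N / 2 * Real.log ((4 / N) • gaussianGradientMatrix n u + 1).det := by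
  set A := (4 / N) • gaussianGradientMatrix n u + 1 with hAdef
  have hA : A.IsHermitian := by
    refine Matrix.IsHermitian.add ?_ Matrix.isHermitian_one
    ext i j
    simp [gaussianGradientMatrix, mul_comm]
  -- The basis that diagonalises the gradient matrix makes the product of the directional factors
  -- equal to the determinant.
  set b := hA.eigenvectorBasis with hb
  have huc := hu.continuous
  have hu2s : HasCompactSupport fun x => u x ^ 2 := by
    simp only [pow_two]
    exact hs.mul_right
  have hnorm : ∀ i, ∑ j, b i j * b i j = 1 := by
    intro i
    have := b.norm_eq_one i
    rw [EuclideanSpace.norm_eq, Real.sqrt_eq_one] at this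
    simpa [pow_two] using this
  -- The off-diagonal moment conditions make isotropy independent of the basis, so it holds along
  -- the eigenvectors.
  have hisob : ∀ i, ∫ x, inner ℝ x (b i) ^ 2 * u x ^ 2 ∂(stdGaussian (EuclideanSpace ℝ (Fin n))) =
      ∫ x, u x ^ 2 ∂(stdGaussian (EuclideanSpace ℝ (Fin n))) := by
    intro i
    rw [integral_inner_sq_mul_eq_sum (fun x => x) (fun x => u x ^ 2)]
    · simp only [hiso, ite_mul, zero_mul, Finset.sum_ite_eq, Finset.mem_univ, if_true, ← hN]
      calc _ = N * ∑ j, b i j * b i j := by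
            rw [Finset.mul_sum]; exact Finset.sum_congr rfl fun j _ => by ring
        _ = N := by rw [hnorm, mul_one]
    · intro j k
      exact integrable_stdGaussian_of_hasCompactSupport (by fun_prop) hu2s.mul_left
  have hgrad : ∀ x c, fderiv ℝ u x c = inner ℝ (∇ u x) c := fun x c => by
    rw [← toDual_gradient]; simp
  have hgc : Continuous fun x => ∇ u x :=
    (InnerProductSpace.toDual ℝ _).symm.continuous.comp (hu.continuous_fderiv one_ne_zero)
  have hgs : HasCompactSupport fun x => ∇ u x :=
    (hs.fderiv ℝ).comp_left (g := (InnerProductSpace.toDual ℝ _).symm) (map_zero _)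
  have hK : ∀ i, ∫ x, fderiv ℝ u x (b i) ^ 2 ∂(stdGaussian (EuclideanSpace ℝ (Fin n))) =
      b i ⬝ᵥ (gaussianGradientMatrix n u).mulVec (b i) := by
    intro i
    have h := integral_inner_sq_mul_eq_sum (μ := stdGaussian (EuclideanSpace ℝ (Fin n)))
      (fun x => ∇ u x) (fun _ => 1) (fun j k => by
        simp only [mul_one]
        refine integrable_stdGaussian_of_hasCompactSupport (by fun_prop) ?_
        have : HasCompactSupport fun x => (∇ u x) j :=
          hgs.comp_left (g := fun y : EuclideanSpace ℝ (Fin n) => y j) rfl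
        exact this.mul_right) (b i)
    simp only [mul_one] at h
    simp only [hgrad]
    exact h
  have heig : ∀ i, hA.eigenvalues i =
      4 / N * (∫ x, fderiv ℝ u x (b i) ^ 2 ∂(stdGaussian (EuclideanSpace ℝ (Fin n)))) + 1 := by
    intro i
    have hmul : A.mulVec (b i) = (4 / N) • (gaussianGradientMatrix n u).mulVec (b i) + b i := by
      rw [hAdef, Matrix.add_mulVec, Matrix.smul_mulVec, Matrix.one_mulVec]
    have hone : b i ⬝ᵥ b i = 1 := hnorm i
    rw [hK, hA.eigenvalues_eq, ← hb, hmul]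
    simp [hone]
  have hdet : A.det = ∏ i, hA.eigenvalues i := by
    simpa using hA.det_eq_prod_eigenvalues
  have heigpos : ∀ i, 0 < hA.eigenvalues i := fun i => by
    rw [heig]
    have : 0 ≤ ∫ x, fderiv ℝ u x (b i) ^ 2 ∂(stdGaussian (EuclideanSpace ℝ (Fin n))) :=
      integral_nonneg fun x => sq_nonneg _
    positivity
  refine ⟨hdet ▸ Finset.prod_pos fun i _ => heigpos i, ?_⟩
  rw [hdet, Real.log_prod fun i _ => (heigpos i).ne']
  simp only [heig]
  have := gaussian_entropy_sq_le_sum_log b hu hs hisob (hN ▸ hpos)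
  rwa [← hN] at this

theorem theorem1 (n : ℕ) (u : EuclideanSpace ℝ (Fin n) → ℝ)
    (hu : ContDiff ℝ ∞ u) (hsupp : HasCompactSupport u) (hu0 : u ≠ 0)
    (hnorm : ∀ i j : Fin n,
      ∫ x, x i * x j * u x ^ 2 ∂(stdGaussian (EuclideanSpace ℝ (Fin n)))
        = if i = j then gaussianLpNorm n 2 u ^ 2 else 0)
    (p : ℝ) (hp : p ∈ Set.Ico (1 : ℝ) 2) :
    (gaussianLpNorm n 2 u ^ 2 - gaussianLpNorm n p u ^ 2) / gaussianLpNorm n 2 u ^ 2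
      ≤ 1 - ((4 / gaussianLpNorm n 2 u ^ 2) • gaussianGradientMatrix n u + 1).det
              ^ (-((2 - p) / (2 * p))) := by
  have hu1 : ContDiff ℝ 1 u := hu.of_le (by exact_mod_cast le_top)
  have huc := hu1.continuous
  have hp0 : 0 < p := zero_lt_one.trans_le hp.1
  set N := gaussianLpNorm n 2 u ^ 2 with hNdef
  have hN : N = ∫ x, u x ^ 2 ∂(stdGaussian (EuclideanSpace ℝ (Fin n))) :=
    gaussianLpNorm_two_sq huc hsupp
  have hu2s : HasCompactSupport fun x => u x ^ 2 := by
    simp only [pow_two]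
    exact hsupp.mul_right
  have hpos : 0 < N := by
    obtain ⟨x, hx⟩ := Function.ne_iff.1 hu0
    have hx2 : stdGaussianDensity _ x * u x ^ 2 ≠ 0 :=
      mul_ne_zero (stdGaussianDensity_pos x).ne' (pow_ne_zero 2 hx)
    rw [hN, integral_stdGaussian]
    exact Continuous.integral_pos_of_hasCompactSupport_nonneg_nonzero
      (contDiff_stdGaussianDensity (m := 0).continuous.mul (huc.pow 2)) hu2s.mul_left
      (fun y => mul_nonneg (stdGaussianDensity_pos y).le (sq_nonneg _)) hx2
  obtain ⟨hdet, hent⟩ := gaussian_entropy_sq_le_log_det hu1 hsupp hN hpos hnorm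
  set D := ((4 / N) • gaussianGradientMatrix n u + 1).det with hD
  have hint := integrable_stdGaussian_of_hasCompactSupport (huc.pow 2) hu2s
  have hintlog := integrable_stdGaussian_of_hasCompactSupport
    (Real.continuous_mul_log.comp (huc.pow 2)) hu2s.mul_log
  have hintp : Integrable (fun x => |u x| ^ p) (stdGaussian (EuclideanSpace ℝ (Fin n))) :=
    integrable_stdGaussian_of_hasCompactSupport
      (huc.abs.rpow_const fun x => Or.inr hp0.le)
      (hsupp.comp_left (g := fun t : ℝ => |t| ^ p) (by simp [Real.zero_rpow hp0.ne']))
  have hjensen := integral_rpow_ge_exp_entropy hp0 hint hintlog hintp (hN ▸ hpos)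
  rw [← hN] at hjensen
  set H := ∫ x, u x ^ 2 * Real.log (u x ^ 2) ∂(stdGaussian (EuclideanSpace ℝ (Fin n)))
  set S := ∫ x, |u x| ^ p ∂(stdGaussian (EuclideanSpace ℝ (Fin n)))
  have hS : 0 < S := (mul_pos hpos (Real.exp_pos _)).trans_le hjensen
  have hlogS : Real.log N + (p - 2) / 2 * (H / N) ≤ Real.log S := by
    have := Real.log_le_log (mul_pos hpos (Real.exp_pos _)) hjensen
    rwa [Real.log_mul hpos.ne' (Real.exp_pos _).ne', Real.log_exp] at this
  have hHN : H / N ≤ Real.log N + Real.log D / 2 := by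
    rw [div_le_iff₀ hpos]
    linarith
  -- In logarithms, the Jensen and entropy bounds combine linearly; `p < 2` keeps the direction, and
  -- the factor `2/p` converts `log S` into the logarithm of the squared norm.
  have hfinal : N * D ^ (-((2 - p) / (2 * p))) ≤ gaussianLpNorm n p u ^ 2 := by
    rw [gaussianLpNorm_eq huc hsupp hp0]
    rw [← Real.log_le_log_iff (mul_pos hpos (Real.rpow_pos_of_pos hdet _))
      (pow_pos (Real.rpow_pos_of_pos hS _) 2), Real.log_mul hpos.ne'
      (Real.rpow_pos_of_pos hdet _).ne', Real.log_rpow hdet, Real.log_pow (S ^ p⁻¹) 2, Real.log_rpow hS]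
    have h1 : (2 - p) / 2 * (H / N) ≤ (2 - p) / 2 * (Real.log N + Real.log D / 2) :=
      mul_le_mul_of_nonneg_left hHN (by linarith [hp.2])
    have h2 : p / 2 * Real.log N - (2 - p) / 4 * Real.log D ≤ Real.log S := by linarith
    have h3 := mul_le_mul_of_nonneg_left h2 (by positivity : 0 ≤ 2 / p)
    have h4 : 2 / p * (p / 2 * Real.log N - (2 - p) / 4 * Real.log D) =
        Real.log N + -((2 - p) / (2 * p)) * Real.log D := by
      field_simp
      ring
    rw [h4] at h3
    refine h3.trans_eq ?_
    push_cast
    ring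
  rw [sub_div, div_self hpos.ne']
  have := (le_div_iff₀ hpos).2 ((mul_comm _ _).trans_le hfinal)
  linarith
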